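/- Let $\mathbb X\subseteq\mathbb R^d$ be open, let $\rho$ be a $\sigma$-finite measure on $\mathbb X$, and let $p(y\mid x)$, $q(y\mid x)$ be (jointly measurable) transition densities on $\mathbb X$ with respect to $\rho$ (pre- and post-change). Let $P(x,A)=\int_A p(y\mid x)\,d\rho(y)$. Define the conditional Hyvärinen score $$S_H(y,x;p)=\tfrac12\|\nabla_y\log p(y\mid x)\|^2+\Delta_y\log p(y\mid x)$$ (with fixed conventional values at points where the density vanishes or the derivatives do not exist), the score difference $s(y,x)=S_H(y,x;p)-S_H(y,x;q)$, assumed measurable, and for $M>0$ the truncation $\varphi(u)=\max(-M,\min(u,M))$. Put $\|\varphi\|=\sup\{|\varphi(s(y,x))| : x,y\in\mathbb X,\ p(y\mid x)>0\}\le M<\infty$. Assume that $P$ is uniformly ergodic with stationary law $\pi$, i.e. $\pi P=\pi$ and $\sup_{x}\|P^n(x,\cdot)-\pi\|_{TV}\to0$. Let $(X_t)_{t\ge0}$ be the Markov chain with kernel $P$ and $X_0\sim\pi$ (no change ever occurs; expectation $\mathbb E_\infty$), and assume $$\mathbb E_\infty[\varphi(s(X_1,X_0))]=-\delta<0 .$$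 Let $T(b)=\inf\{n\ge1:\max_{1\le k\le n}\sum_{t=k}^n\varphi(s(X_t,X_{t-1}))\ge b\}$ (with $\inf\emptyset=\infty$), and let $\tilde P$ be the transition kernel of the pair chain $B_t=(X_t,X_{t-1})$, which moves from $(x,x')$ to $(Y,x)$ with $Y\sim P(x,\cdot)$. Then $\tilde P$ satisfies Doeblin's condition: there are an integer $\tilde l\ge1$, a constant $\tilde\lambda>0$ and a probability measure $\nu$ on $\mathbb X\times\mathbb X$ with $\tilde P^{\tilde l}(z,\cdot)\ge\tilde\lambda\,\nu(\cdot)$ for all $z\in\mathbb X\times\mathbb X$. Moreover, for every such pair of constants $(\tilde l,\tilde\lambda)$, with $\mu=2(\tilde l+1)\|\varphi\|/\tilde\lambda$, and every threshold $b>\mu$, $$\mathbb E_\infty[T(b)]\ \ge\ \frac{2\sqrt2}{3}\exp\!\Big(\frac{4\delta(b-\mu)}{\mu^2}\Big).$$ -/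

import Mathlib

open MeasureTheory ProbabilityTheory Filter Set
open scoped ENNReal Topology Gradient Laplacian

namespace ScoreCUSUM

noncomputable section

/-! ### Markov kernels and Markov chains -/

/-- `K` satisfies Doeblin's condition with constants `(l, lam)`: `l ≥ 1`, `lam > 0`, and there is a
probability measure `ν` such that `K^l(x, ·) ≥ lam • ν` for every state `x`. -/
def Doeblin {S : Type*} [MeasurableSpace S] (K : Kernel S S) (l : ℕ) (lam : ℝ) : Prop :=
  1 ≤ l ∧ 0 < lam ∧ ∃ ν : Measure S, IsProbabilityMeasure ν ∧
    ∀ x : S, ENNReal.ofReal lam • ν ≤ (K ^ l) x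

/-- Uniform ergodicity: `π` is invariant for `K`, and `K^n(x, ·)` converges to `π` in total
variation, uniformly in the starting state `x`. -/
def UniformlyErgodic {S : Type*} [MeasurableSpace S] (K : Kernel S S) (π : Measure S) : Prop :=
  Kernel.Invariant K π ∧
    ∀ ε : ℝ, 0 < ε → ∀ᶠ n : ℕ in atTop, ∀ (x : S) (A : Set S), MeasurableSet A →
      |((K ^ n) x).real A - π.real A| ≤ ε

/-- `X` is, under `Pr`, a time-homogeneous Markov chain with initial law `π` and transition kernel
`K`: for every `n`, the conditional law of `X (n+1)` given `(X 0, …, X n)` is `K (X n, ·)`. -/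
structure IsMarkovChain {S Ω : Type*} [MeasurableSpace S] [MeasurableSpace Ω]
    (X : ℕ → Ω → S) (π : Measure S) (K : Kernel S S) (Pr : Measure Ω) : Prop where
  measurable : ∀ n, Measurable (X n)
  initial : HasLaw (X 0) π Pr
  markov : ∀ n, HasCondDistrib (X (n + 1)) (fun ω (i : Fin (n + 1)) => X i ω)
    (K.comap (fun h : Fin (n + 1) → S => h (Fin.last n)) (measurable_pi_apply _)) Pr

/-- The transition kernel of the pair chain `B_t = (X_t, X_{t-1})` of a chain with kernel `K`:
from `(x, x')` it moves to `(Y, x)` with `Y ∼ K(x, ·)`. -/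
def pairKernel {S : Type*} [MeasurableSpace S] (K : Kernel S S) : Kernel (S × S) (S × S) :=
  (K ×ₖ Kernel.id).comap Prod.fst measurable_fst

/-! ### Conditional densities and conditional Hyvärinen scores

A conditional density on a state space `𝕏 ⊆ ℝ^d` is written `p x y` for `p(y | x)`. The second
argument is typed in `ℝ^d` so that derivatives in `y` can be taken; only the values at
`y ∈ 𝕏` are ever used when `𝕏` is open. -/

/-- `p(· | ·)` is a transition density on `𝕏` with respect to `ρ`. -/
structure IsTransitionDensity {d : ℕ} {𝕏 : Set (EuclideanSpace ℝ (Fin d))}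
    (ρ : Measure 𝕏) (p : 𝕏 → EuclideanSpace ℝ (Fin d) → ℝ) : Prop where
  measurable : Measurable (fun z : 𝕏 × 𝕏 => p z.1 z.2)
  nonneg : ∀ x y : 𝕏, 0 ≤ p x y
  lintegral_eq_one : ∀ x : 𝕏, ∫⁻ y : 𝕏, ENNReal.ofReal (p x y) ∂ρ = 1

/-- The conditional Hyvärinen score
`S_H(y, x; p) = ½ ‖∇_y log p(y | x)‖² + Δ_y log p(y | x)`. -/
def hyvarinenScore {d : ℕ} {𝕏 : Set (EuclideanSpace ℝ (Fin d))}
    (p : 𝕏 → EuclideanSpace ℝ (Fin d) → ℝ) (y x : 𝕏) : ℝ :=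
  (1 / 2) * ‖∇ (fun y' => Real.log (p x y')) (y : EuclideanSpace ℝ (Fin d))‖ ^ 2
    + (Δ (fun y' => Real.log (p x y'))) (y : EuclideanSpace ℝ (Fin d))

/-- The conditional Hyvärinen score difference `s(y, x) = S_H(y, x; p) - S_H(y, x; q)`. -/
def scoreDiff {d : ℕ} {𝕏 : Set (EuclideanSpace ℝ (Fin d))}
    (p q : 𝕏 → EuclideanSpace ℝ (Fin d) → ℝ) (y x : 𝕏) : ℝ :=
  hyvarinenScore p y x - hyvarinenScore q y x

/-- The truncation `φ` at level `M`. -/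
def trunc (M x : ℝ) : ℝ :=
  if |x| ≤ M then x else if M < x then M else -M

/-- `‖φ‖`: the supremum of `|φ(s(y, x))|` over all transition pairs `(y, x)`, i.e. those with
`p(y | x) > 0`. -/
def truncScoreNorm {d : ℕ} {𝕏 : Set (EuclideanSpace ℝ (Fin d))}
    (p q : 𝕏 → EuclideanSpace ℝ (Fin d) → ℝ) (M : ℝ) : ℝ :=
  ⨆ z : {z : 𝕏 × 𝕏 // 0 < p z.2 z.1}, |trunc M (scoreDiff p q z.1.1 z.1.2)|

/-! ### The truncated score-based CUSUM procedure -/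

/-- The CUSUM statistic `max_{1 ≤ k ≤ n} ∑_{t=k}^n f(X_t, X_{t-1})` along a path `x`. -/
def cusum {S : Type*} (f : S → S → ℝ) (x : ℕ → S) (n : ℕ) : ℝ :=
  ⨆ k : Finset.Icc 1 n, ∑ t ∈ Finset.Icc (k : ℕ) n, f (x t) (x (t - 1))

/-- The first `n ≥ 1` at which the CUSUM statistic is at least `b` (`⊤` if there is none). -/
def cusumTime {S : Type*} (f : S → S → ℝ) (b : ℝ) (x : ℕ → S) : ℕ∞ :=
  ⨅ (n : ℕ) (_ : 1 ≤ n ∧ b ≤ cusum f x n), (n : ℕ∞)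

/-- The truncated score-based CUSUM stopping time `T(b)`. -/
def stoppingTime {d : ℕ} {𝕏 : Set (EuclideanSpace ℝ (Fin d))} {Ω : Type*}
    (p q : 𝕏 → EuclideanSpace ℝ (Fin d) → ℝ) (M b : ℝ) (X : ℕ → Ω → 𝕏) (ω : Ω) : ℕ∞ :=
  cusumTime (fun y x => trunc M (scoreDiff p q y x)) b (fun t => X t ω)

end

end ScoreCUSUM

/-!
The pair chain `B_t = (X_t, X_{t-1})` with kernel `K̃` satisfies Doeblin's condition as soon as `P`
does, since `K̃^(m+1)` is `P^m` followed by one more step. For `P` itself, choose `n` with `P^n(x, ·)`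
uniformly within `1/10` of `π`. The density of `P^n(z, ·)` with respect to `π` is then at least `1/2`
off a set of `π`-measure `1/5`, so by Fubini and Markov's inequality there is a set `C` with
`π C ≥ 1/2` such that every `y ∈ C` is reached with density at least `1/2` from most `z`; hence
`P^(2n)(x, ·)` dominates a multiple of `π` restricted to `C`, uniformly in `x`
(`exists_minorization_sq`). Only the part of `P^n(z, ·)` that is absolutely continuous with respect
to `π` matters, so `Kernel.rnDeriv` supplies the jointly measurable density.

For the bound on the mean of `T(b)`, the partial sums `U_m = ∑_{j < m} K̃^j f` of the Poisson equation
for the clipped score `f`, `|f| ≤ ‖φ‖`, have oscillation at most `2 l ‖φ‖ / λ ≤ μ`, because `K̃^l`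
contracts oscillations by `1 - λ` (`Doeblin.potential_oscLE`). Since
`f + K̃ U_m = U_{m+1}`, Hoeffding's lemma applied to `U_{m+1}` under `K̃(z, ·)` gives an exponential
supermartingale, and so
`E exp (θ ∑_{t < m} f(B_{s+t+1})) ≤ exp (θ (μ - m δ) + m θ² μ² / 8)`. The choice `θ = 8 δ / μ²` removes
the dependence on `m`, and each block of transitions reaches the level `b` with probability at most
`e^{-2a}`, where `a = 4 δ (b - μ) / μ²` (`IsMarkovChain.measure_sum_ge_le`).

At most `n (n + 1) / 2` blocks end by time `n`, so `Pr(T(b) ≤ n) ≤ n (n + 1) / 2 · e^{-2a}`. Summing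
`Pr(T(b) > n)` over `n < N` gives `E T(b) ≥ N - e^{-2a} (N³ - N) / 6`, and the integer `N` nearest to
`√2 e^a` makes this at least `(2 √2 / 3) e^a` (`le_lintegral_cusumTime`).
-/

namespace ScoreCUSUM

/-! ### Oscillation of functions along a kernel -/

section Oscillation

variable {S : Type*} [MeasurableSpace S]

/-- The function `u` takes its values in an interval of length `c`; that is, its oscillation is at
most `c`. -/
def OscLE (u : S → ℝ) (c : ℝ) : Prop := ∃ a : ℝ, ∀ z, u z ∈ Icc a (a + c)

/-- The action `z ↦ ∫ u dK(z, ·)` of a kernel `K` on functions. -/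
noncomputable def kernelMean (K : Kernel S S) (u : S → ℝ) (z : S) : ℝ := ∫ w, u w ∂(K z)

omit [MeasurableSpace S] in
theorem OscLE.mono {u : S → ℝ} {c c' : ℝ} (h : OscLE u c) (hc : c ≤ c') : OscLE u c' := by
  obtain ⟨a, ha⟩ := h
  exact ⟨a, fun z => ⟨(ha z).1, (ha z).2.trans (by linarith)⟩⟩

omit [MeasurableSpace S] in
theorem OscLE.add {u v : S → ℝ} {c c' : ℝ} (hu : OscLE u c) (hv : OscLE v c') :
    OscLE (u + v) (c + c') := by
  obtain ⟨a, ha⟩ := hu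
  obtain ⟨a', ha'⟩ := hv
  refine ⟨a + a', fun z => ⟨add_le_add (ha z).1 (ha' z).1, ?_⟩⟩
  have := add_le_add (ha z).2 (ha' z).2
  simp only [Pi.add_apply]
  linarith

omit [MeasurableSpace S] in
theorem OscLE.of_abs_le {u : S → ℝ} {B : ℝ} (h : ∀ z, |u z| ≤ B) : OscLE u (2 * B) :=
  ⟨-B, fun z => ⟨(abs_le.1 (h z)).1, by linarith [(abs_le.1 (h z)).2]⟩⟩

theorem OscLE.integrable {u : S → ℝ} {c : ℝ} (h : OscLE u c) (hu : Measurable u)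
    (ν : Measure S) [IsFiniteMeasure ν] : Integrable u ν := by
  obtain ⟨a, ha⟩ := h
  exact Integrable.of_mem_Icc a (a + c) hu.aemeasurable (.of_forall ha)

theorem measurable_kernelMean (K : Kernel S S) {u : S → ℝ} (hu : Measurable u) :
    Measurable (kernelMean K u) :=
  (StronglyMeasurable.integral_kernel hu.stronglyMeasurable).measurable

theorem integral_mem_Icc {ν : Measure S} [IsProbabilityMeasure ν] {u : S → ℝ} {a b : ℝ}
    (hu : Measurable u) (h : ∀ z, u z ∈ Icc a b) : ∫ z, u z ∂ν ∈ Icc a b := by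
  have hi : Integrable u ν := Integrable.of_mem_Icc a b hu.aemeasurable (.of_forall h)
  constructor
  · simpa using integral_mono (integrable_const a) hi (fun z => (h z).1)
  · simpa using integral_mono hi (integrable_const b) (fun z => (h z).2)

theorem OscLE.kernelMean {u : S → ℝ} {c : ℝ} (h : OscLE u c) (hu : Measurable u)
    (K : Kernel S S) [IsMarkovKernel K] : OscLE (kernelMean K u) c := by
  obtain ⟨a, ha⟩ := h
  exact ⟨a, fun z => integral_mem_Icc hu ha⟩

theorem kernelMean_add (K : Kernel S S) [IsMarkovKernel K] {u v : S → ℝ} {c c' : ℝ}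
    (hu : Measurable u) (hv : Measurable v) (hc : OscLE u c) (hc' : OscLE v c') :
    kernelMean K (u + v) = kernelMean K u + kernelMean K v := by
  ext z
  exact integral_add (hc.integrable hu _) (hc'.integrable hv _)

theorem kernelMean_comp (K L : Kernel S S) [IsMarkovKernel K] [IsMarkovKernel L] {u : S → ℝ}
    {c : ℝ} (hu : Measurable u) (hc : OscLE u c) :
    kernelMean (L ∘ₖ K) u = kernelMean K (kernelMean L u) := by
  ext z
  exact Kernel.integral_comp (hc.integrable hu _)

/-- A kernel with a minorization `lam • ν ≤ K(z, ·)` contracts oscillations by the factor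
`1 - lam`. -/
theorem OscLE.kernelMean_of_minorization {u : S → ℝ} {c lam : ℝ} (h : OscLE u c)
    (hu : Measurable u) (K : Kernel S S) [IsMarkovKernel K] (hlam : 0 ≤ lam)
    {ν : Measure S} [IsProbabilityMeasure ν]
    (hν : ∀ z, ENNReal.ofReal lam • ν ≤ K z) :
    OscLE (ScoreCUSUM.kernelMean K u) ((1 - lam) * c) := by
  have hui := h.integrable hu ν
  have huK : ∀ z, Integrable u (K z) := fun z => h.integrable hu _
  obtain ⟨a, ha⟩ := h
  have key : ∀ (v : S → ℝ) (z : S), (∀ w, 0 ≤ v w) → Integrable v (K z) →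
      lam * ∫ w, v w ∂ν ≤ ∫ w, v w ∂(K z) := by
    intro v z hv hvi
    have := integral_mono_measure (hν z) (.of_forall hv) hvi
    rwa [integral_smul_measure, ENNReal.toReal_ofReal hlam, smul_eq_mul] at this
  refine ⟨lam * ∫ w, u w ∂ν + (1 - lam) * a, fun z => ⟨?_, ?_⟩⟩
  · have := key (fun w => u w - a) z (fun w => by linarith [(ha w).1])
      ((huK z).sub (integrable_const a))
    rw [integral_sub hui (integrable_const a),
      integral_sub (huK z) (integrable_const a)] at this
    simp only [integral_const, probReal_univ, smul_eq_mul, one_mul] at this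
    simp only [ScoreCUSUM.kernelMean]
    linarith
  · have := key (fun w => (a + c) - u w) z (fun w => by linarith [(ha w).2])
      ((integrable_const _).sub (huK z))
    rw [integral_sub (integrable_const _) hui,
      integral_sub (integrable_const _) (huK z)] at this
    simp only [integral_const, probReal_univ, smul_eq_mul, one_mul] at this
    simp only [ScoreCUSUM.kernelMean]
    linarith

instance isMarkovKernel_pow (K : Kernel S S) [IsMarkovKernel K] (n : ℕ) :
    IsMarkovKernel (K ^ n) := by
  induction n with
  | zero => exact inferInstanceAs (IsMarkovKernel Kernel.id)
  | succ n ih => rw [Kernel.pow_add]; rw [pow_one]; infer_instance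

theorem Doeblin.lam_le_one {K : Kernel S S} [IsMarkovKernel K] [Nonempty S] {l : ℕ} {lam : ℝ}
    (h : Doeblin K l lam) : lam ≤ 1 := by
  obtain ⟨-, -, ν, hν, hle⟩ := h
  have := hle (Classical.arbitrary S) univ
  simpa using this

/-! ### Partial sums of the Poisson equation -/

/-- The partial sum `∑_{j < m} K^j f` of the solution of the Poisson equation for `f`, defined by
the recursion `U_{m+1} = f + K U_m`. -/
noncomputable def potential (K : Kernel S S) (f : S → ℝ) : ℕ → S → ℝ
  | 0 => 0
  | m + 1 => f + kernelMean K (potential K f m)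

theorem measurable_potential (K : Kernel S S) {f : S → ℝ} (hf : Measurable f) (m : ℕ) :
    Measurable (potential K f m) := by
  induction m with
  | zero => exact measurable_const
  | succ m ih => exact hf.add (measurable_kernelMean K ih)

theorem potential_oscLE_linear (K : Kernel S S) [IsMarkovKernel K] {f : S → ℝ}
    (hf : Measurable f) {c : ℝ} (hc : OscLE f c) (m : ℕ) : OscLE (potential K f m) (m * c) := by
  induction m with
  | zero => exact ⟨0, fun z => by simp [potential]⟩
  | succ m ih =>
    have := hc.add (ih.kernelMean (measurable_potential K hf m) K)
    exact this.mono (by push_cast; linarith)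

theorem potential_add (K : Kernel S S) [IsMarkovKernel K] {f : S → ℝ}
    (hf : Measurable f) {c : ℝ} (hc : OscLE f c) (l m : ℕ) :
    potential K f (l + m) = potential K f l + kernelMean (K ^ l) (potential K f m) := by
  have hm := measurable_potential K hf m
  have hom := potential_oscLE_linear K hf hc m
  induction l with
  | zero =>
    have : kernelMean (K ^ 0) (potential K f m) = potential K f m := by
      ext z
      change ∫ w, potential K f m w ∂(Kernel.id z) = _
      rw [Kernel.id_apply, integral_dirac' _ _ hm.stronglyMeasurable]
    rw [this, Nat.zero_add]
    simp [potential]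
  | succ l ih =>
    rw [Nat.add_right_comm, potential, ih, kernelMean_add K (measurable_potential K hf l)
      (measurable_kernelMean _ hm) (potential_oscLE_linear K hf hc l) (hom.kernelMean hm _),
      ← kernelMean_comp K (K ^ l) hm hom, Kernel.pow_add K l 1, pow_one, potential, add_assoc]

/-- Under Doeblin's condition the partial sums of the Poisson equation have uniformly bounded
oscillation: the oscillation of the terms `K^j f` decays like `(1 - lam)^⌊j/l⌋`. -/
theorem Doeblin.potential_oscLE {K : Kernel S S} [IsMarkovKernel K] [Nonempty S]
    {l : ℕ} {lam : ℝ} (hK : Doeblin K l lam) {f : S → ℝ}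
    (hf : Measurable f) {c : ℝ} (hc0 : 0 ≤ c) (hc : OscLE f c) (m : ℕ) :
    OscLE (potential K f m) (l * c / lam) := by
  have h1 := hK.lam_le_one
  obtain ⟨hl, hlam, ν, hν, hle⟩ := hK
  induction m using Nat.strong_induction_on with
  | _ m ih =>
    by_cases hml : m < l
    · refine (potential_oscLE_linear K hf hc m).mono ?_
      rw [le_div_iff₀ hlam]
      have : (m : ℝ) ≤ l := by exact_mod_cast hml.le
      calc m * c * lam ≤ m * c * 1 := by gcongr
        _ ≤ l * c := by rw [mul_one]; gcongr
    · obtain ⟨j, rfl⟩ := Nat.exists_eq_add_of_le (not_lt.1 hml)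
      rw [potential_add K hf hc]
      refine ((potential_oscLE_linear K hf hc l).add ((ih j (by omega)).kernelMean_of_minorization
        (measurable_potential K hf j) (K ^ l) hlam.le hle)).mono (le_of_eq ?_)
      field_simp
      ring

theorem integral_kernelMean_of_invariant {K : Kernel S S} [IsMarkovKernel K] {η : Measure S}
    [IsProbabilityMeasure η] (hη : Kernel.Invariant K η) {u : S → ℝ} {c : ℝ}
    (hu : Measurable u) (hc : OscLE u c) :
    ∫ z, kernelMean K u z ∂η = ∫ z, u z ∂η := by
  have h := Kernel.integral_comp (η := K) (κ := Kernel.const Unit η) (a := ()) (f := u)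
    (hc.integrable hu _)
  rw [Kernel.comp_apply, Kernel.const_apply, hη.def] at h
  exact h.symm

theorem integral_potential_of_invariant {K : Kernel S S} [IsMarkovKernel K] {η : Measure S}
    [IsProbabilityMeasure η] (hη : Kernel.Invariant K η) {f : S → ℝ} {c : ℝ}
    (hf : Measurable f) (hc : OscLE f c) (m : ℕ) :
    ∫ z, potential K f m z ∂η = m * ∫ z, f z ∂η := by
  induction m with
  | zero => simp [potential]
  | succ m ih =>
    have hm := measurable_potential K hf m
    have hom := potential_oscLE_linear K hf hc m
    simp only [potential, Pi.add_apply]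
    rw [integral_add (hc.integrable hf _)
      ((hom.kernelMean hm K).integrable (measurable_kernelMean K hm) _),
      integral_kernelMean_of_invariant hη hm hom, ih]
    push_cast
    ring

/-- Hoeffding's lemma for a function of oscillation at most `R`. -/
theorem OscLE.lintegral_exp_le {ν : Measure S} [IsProbabilityMeasure ν] {u : S → ℝ} {R : ℝ}
    (h : OscLE u R) (hu : Measurable u) (θ : ℝ) :
    ∫⁻ z, ENNReal.ofReal (Real.exp (θ * u z)) ∂ν
      ≤ ENNReal.ofReal (Real.exp (θ * ∫ z, u z ∂ν + θ ^ 2 * R ^ 2 / 8)) := by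
  obtain ⟨a, ha⟩ := h
  have hsub := hasSubgaussianMGF_of_mem_Icc (μ := ν) hu.aemeasurable (.of_forall ha)
  have hint := hsub.integrable_exp_mul θ
  have hle := hsub.mgf_le θ
  simp only [mgf] at hle
  set e : ℝ := ∫ z, u z ∂ν with he
  have hrw : ∀ z, Real.exp (θ * u z) = Real.exp (θ * e) * Real.exp (θ * (u z - e)) := by
    intro z
    rw [← Real.exp_add]
    ring_nf
  simp_rw [hrw]
  rw [← ofReal_integral_eq_lintegral_ofReal (hint.const_mul _)
    (.of_forall fun z => by positivity), integral_const_mul, Real.exp_add]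
  refine ENNReal.ofReal_le_ofReal (mul_le_mul_of_nonneg_left (hle.trans (le_of_eq ?_))
    (Real.exp_pos _).le)
  congr 1
  simp only [add_sub_cancel_left, NNReal.coe_pow, NNReal.coe_div, coe_nnnorm, Real.norm_eq_abs,
    NNReal.coe_ofNat, div_pow, sq_abs]
  ring

end Oscillation

end ScoreCUSUM

namespace ScoreCUSUM

/-! ### The pair chain and exponential moments of its additive functionals -/

section PairChain

variable {S : Type*} [MeasurableSpace S]

instance isMarkovKernel_pairKernel (K : Kernel S S) [IsMarkovKernel K] :
    IsMarkovKernel (pairKernel K) := by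
  unfold pairKernel
  infer_instance

theorem pairKernel_apply (K : Kernel S S) (z : S × S) :
    pairKernel K z = (K ×ₖ Kernel.id) z.1 := by
  rw [pairKernel, Kernel.comap_apply]

theorem lintegral_pairKernel (K : Kernel S S) [IsMarkovKernel K] {φ : S × S → ℝ≥0∞}
    (hφ : Measurable φ) (z : S × S) :
    ∫⁻ w, φ w ∂(pairKernel K z) = ∫⁻ y, φ (y, z.1) ∂(K z.1) := by
  rw [pairKernel_apply, Kernel.lintegral_prod_id hφ]

/-- The law of `(Y, x)` with `x ∼ π` and `Y ∼ K(x, ·)`. -/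
noncomputable def pairLaw (K : Kernel S S) (π : Measure S) : Measure (S × S) :=
  π.bind (K ×ₖ Kernel.id)

instance isProbabilityMeasure_pairLaw (K : Kernel S S) [IsMarkovKernel K] (π : Measure S)
    [IsProbabilityMeasure π] : IsProbabilityMeasure (pairLaw K π) := by
  unfold pairLaw
  infer_instance

theorem lintegral_pairLaw (K : Kernel S S) [IsMarkovKernel K] (π : Measure S)
    {φ : S × S → ℝ≥0∞} (hφ : Measurable φ) :
    ∫⁻ w, φ w ∂(pairLaw K π) = ∫⁻ x, ∫⁻ y, φ (y, x) ∂(K x) ∂π := by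
  rw [pairLaw, Measure.lintegral_bind (Kernel.aemeasurable _) hφ.aemeasurable]
  simp_rw [Kernel.lintegral_prod_id hφ]

theorem invariant_pairLaw {K : Kernel S S} [IsMarkovKernel K] {π : Measure S}
    (hπ : Kernel.Invariant K π) : Kernel.Invariant (pairKernel K) (pairLaw K π) := by
  ext s hs
  have hm : Measurable fun x : S => (K ×ₖ Kernel.id) x s := Kernel.measurable_coe _ hs
  rw [Measure.bind_apply hs (Kernel.aemeasurable _)]
  simp_rw [pairKernel_apply]
  rw [lintegral_pairLaw K π (φ := fun z => (K ×ₖ Kernel.id) z.1 s) (hm.comp measurable_fst),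
    pairLaw, Measure.bind_apply hs (Kernel.aemeasurable _)]
  conv_rhs => rw [← hπ.def]
  rw [Measure.lintegral_bind (Kernel.aemeasurable _) hm.aemeasurable]

variable {Ω : Type*} [MeasurableSpace Ω] {X : ℕ → Ω → S} {π : Measure S} {K : Kernel S S}
  [IsMarkovKernel K] {Pr : Measure Ω} [IsProbabilityMeasure Pr]

/-- One step of the Markov property, for a nonnegative function of the past times a nonnegative
function of the next transition. -/
theorem IsMarkovChain.lintegral_mul_succ (hX : IsMarkovChain X π K Pr) (n : ℕ)
    {g : (Fin (n + 1) → S) → ℝ≥0∞} (hg : Measurable g) {φ : S × S → ℝ≥0∞} (hφ : Measurable φ) :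
    ∫⁻ ω, g (fun i => X i ω) * φ (X (n + 1) ω, X n ω) ∂Pr
      = ∫⁻ ω, g (fun i => X i ω) * ∫⁻ y, φ (y, X n ω) ∂(K (X n ω)) ∂Pr := by
  have hh : Measurable fun (ω : Ω) (i : Fin (n + 1)) => X i ω :=
    measurable_pi_lambda _ fun i => hX.measurable i
  have hlaw : HasLaw _ _ Pr := hX.markov n
  have hF : Measurable fun z : (Fin (n + 1) → S) × S =>
      g z.1 * φ (z.2, z.1 (Fin.last n)) := by fun_prop
  have h1 := hlaw.lintegral_comp hF.aemeasurable
  simp only [Fin.val_last] at h1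
  rw [h1, Measure.lintegral_compProd hF, lintegral_map hF.lintegral_kernel_prod_right' hh]
  refine lintegral_congr fun ω => ?_
  rw [Kernel.comap_apply]
  change ∫⁻ y, g (fun i => X i ω) * φ (y, X n ω) ∂(K (X n ω)) = _
  exact lintegral_const_mul _ (by fun_prop)

theorem IsMarkovChain.hasLaw_pair (hX : IsMarkovChain X π K Pr) :
    HasLaw (fun ω => (X 1 ω, X 0 ω)) (pairLaw K π) Pr := by
  have h1 := hX.measurable 1
  have h0 := hX.measurable 0
  refine ⟨by fun_prop, ?_⟩
  refine Measure.ext_of_lintegral _ fun φ hφ => ?_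
  rw [lintegral_map hφ (by fun_prop), lintegral_pairLaw K π hφ]
  have := hX.lintegral_mul_succ 0 (g := fun _ => 1) measurable_const hφ
  simp only [one_mul, zero_add] at this
  rw [this]
  have hm : Measurable fun x => ∫⁻ y, φ (y, x) ∂(K x) :=
    Measurable.lintegral_kernel_prod_right' (f := fun z : S × S => φ (z.2, z.1)) (by fun_prop)
  exact hX.initial.lintegral_comp hm.aemeasurable

/-- A transition property that holds almost surely from every state holds almost surely along the
chain. -/
theorem IsMarkovChain.ae_transition (hX : IsMarkovChain X π K Pr) {A : Set (S × S)}
    (hA : MeasurableSet A) (h : ∀ x, ∀ᵐ y ∂(K x), (y, x) ∈ A) (n : ℕ) :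
    ∀ᵐ ω ∂Pr, (X (n + 1) ω, X n ω) ∈ A := by
  have hφ : Measurable (Aᶜ.indicator (1 : S × S → ℝ≥0∞)) := measurable_one.indicator hA.compl
  have := hX.lintegral_mul_succ n (g := fun _ => 1) measurable_const hφ
  simp only [one_mul] at this
  have h0 : ∀ x, ∫⁻ y, Aᶜ.indicator (1 : S × S → ℝ≥0∞) (y, x) ∂(K x) = 0 := by
    intro x
    rw [lintegral_eq_zero_iff (by fun_prop)]
    filter_upwards [h x] with y hy
    simp [hy]
  simp_rw [h0] at this
  have h1 := hX.measurable (n + 1)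
  have h2 := hX.measurable n
  rw [lintegral_zero, lintegral_eq_zero_iff (by fun_prop)] at this
  filter_upwards [this] with ω hω
  by_contra hc
  simp [hc] at hω

/-- One step of the exponential supermartingale
`exp (θ ∑_{t < i} f(B_{s+t+1}) + θ (K̃ U_j)(B_{s+i}) + j θ² R² / 8)`, with `U` the partial sums of
the Poisson equation and `i + j` fixed. -/
theorem IsMarkovChain.lintegral_exp_step (hX : IsMarkovChain X π K Pr) {f : S × S → ℝ}
    (hf : Measurable f) {R : ℝ} (hR : ∀ m, OscLE (potential (pairKernel K) f m) R) (θ : ℝ)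
    (s i j : ℕ) :
    ∫⁻ ω, ENNReal.ofReal (Real.exp (θ * (∑ t ∈ Finset.range (i + 1),
        f (X (s + t + 1) ω, X (s + t) ω) + kernelMean (pairKernel K)
          (potential (pairKernel K) f j) (X (s + i + 1) ω, X (s + i + 1) ω)))) ∂Pr
      ≤ ENNReal.ofReal (Real.exp (θ ^ 2 * R ^ 2 / 8)) *
        ∫⁻ ω, ENNReal.ofReal (Real.exp (θ * (∑ t ∈ Finset.range i,
          f (X (s + t + 1) ω, X (s + t) ω) + kernelMean (pairKernel K)
            (potential (pairKernel K) f (j + 1)) (X (s + i) ω, X (s + i) ω)))) ∂Pr := by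
  set K' := pairKernel K with hK'
  set U := potential K' f with hU
  have hUm : ∀ m, Measurable (U m) := measurable_potential K' hf
  let g : (Fin (s + i + 1) → S) → ℝ≥0∞ := fun h =>
    ENNReal.ofReal (Real.exp (θ * ∑ t : Fin i,
      f (h ⟨s + t + 1, by omega⟩, h ⟨s + t, by omega⟩)))
  have hg : Measurable g := by fun_prop
  have hgX : ∀ ω, g (fun a => X a ω) = ENNReal.ofReal (Real.exp (θ * ∑ t ∈ Finset.range i,
      f (X (s + t + 1) ω, X (s + t) ω))) := by
    intro ω
    simp only [g, Finset.sum_range]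
  let φ : S × S → ℝ≥0∞ := fun z => ENNReal.ofReal (Real.exp (θ * U (j + 1) z))
  have hφ : Measurable φ := by
    have := hUm (j + 1)
    fun_prop
  have hstep := hX.lintegral_mul_succ (s + i) hg hφ
  calc _ = ∫⁻ ω, g (fun a => X a ω) * φ (X (s + i + 1) ω, X (s + i) ω) ∂Pr := by
        refine lintegral_congr fun ω => ?_
        rw [hgX, ← ENNReal.ofReal_mul (Real.exp_pos _).le, ← Real.exp_add, Finset.sum_range_succ]
        congr 2
        rw [← mul_add, add_assoc]
        congr 2
    _ = _ := hstep
    _ ≤ ∫⁻ ω, ENNReal.ofReal (Real.exp (θ ^ 2 * R ^ 2 / 8)) *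
        ENNReal.ofReal (Real.exp (θ * (∑ t ∈ Finset.range i,
          f (X (s + t + 1) ω, X (s + t) ω) + kernelMean K' (U (j + 1))
            (X (s + i) ω, X (s + i) ω)))) ∂Pr := by
        refine lintegral_mono fun ω => ?_
        have h := (hR (j + 1)).lintegral_exp_le (ν := K' (X (s + i) ω, X (s + i) ω))
          (hUm (j + 1)) θ
        rw [hK', lintegral_pairKernel K hφ] at h
        calc _ ≤ _ := mul_le_mul_right h _
          _ = _ := by
            rw [hgX, ← ENNReal.ofReal_mul (Real.exp_pos _).le,
              ← ENNReal.ofReal_mul (Real.exp_pos _).le, ← Real.exp_add, ← Real.exp_add]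
            congr 2
            simp only [kernelMean]
            ring
    _ = _ := lintegral_const_mul' _ _ ENNReal.ofReal_ne_top

/-- The exponential moment of an additive functional of `m` successive transitions, started at any
time `s`, of a chain whose Poisson equation has partial sums of oscillation at most `R`. -/
theorem IsMarkovChain.lintegral_exp_sum_le (hX : IsMarkovChain X π K Pr)
    [IsProbabilityMeasure π] (hπ : Kernel.Invariant K π) {f : S × S → ℝ}
    (hf : Measurable f) {R c : ℝ} (hc : OscLE f c)
    (hR : ∀ m, OscLE (potential (pairKernel K) f m) R) {δ : ℝ}
    (hδ : ∫ ω, f (X 1 ω, X 0 ω) ∂Pr = -δ) {θ : ℝ} (hθ : 0 ≤ θ) (s m : ℕ) :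
    ∫⁻ ω, ENNReal.ofReal (Real.exp (θ * ∑ t ∈ Finset.range m,
        f (X (s + t + 1) ω, X (s + t) ω))) ∂Pr
      ≤ ENNReal.ofReal (Real.exp (θ * (R - m * δ) + m * (θ ^ 2 * R ^ 2 / 8))) := by
  set K' := pairKernel K with hK'
  have hUm : ∀ j, Measurable (potential K' f j) := measurable_potential K' hf
  have hmain : ∀ j i : ℕ, ∫⁻ ω, ENNReal.ofReal (Real.exp (θ * (∑ t ∈ Finset.range (i + j),
        f (X (s + t + 1) ω, X (s + t) ω)))) ∂Pr
      ≤ ENNReal.ofReal (Real.exp (j * (θ ^ 2 * R ^ 2 / 8))) *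
        ∫⁻ ω, ENNReal.ofReal (Real.exp (θ * (∑ t ∈ Finset.range i,
          f (X (s + t + 1) ω, X (s + t) ω) + kernelMean K'
            (potential K' f j) (X (s + i) ω, X (s + i) ω)))) ∂Pr := by
    intro j
    induction j with
    | zero => intro i; simp [potential, kernelMean]
    | succ j ih =>
      intro i
      have h1 := ih (i + 1)
      have h2 := hX.lintegral_exp_step hf hR θ s i j
      rw [show i + (j + 1) = i + 1 + j by omega]
      refine (h1.trans (mul_le_mul_right h2 _)).trans (le_of_eq ?_)
      rw [← mul_assoc, ← ENNReal.ofReal_mul (Real.exp_pos _).le, ← Real.exp_add]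
      congr 4
      push_cast
      ring
  have hV : ∀ z, kernelMean K' (potential K' f m) z ≤ R - m * δ := by
    obtain ⟨a, ha⟩ := (hR m).kernelMean (hUm m) K'
    have hinv := invariant_pairLaw hπ
    have hmean := integral_potential_of_invariant hinv hf hc m
    rw [← integral_kernelMean_of_invariant hinv (hUm m) (hR m),
      ← hX.hasLaw_pair.integral_comp hf.aestronglyMeasurable] at hmean
    have hmem := integral_mem_Icc (ν := pairLaw K π) (measurable_kernelMean K' (hUm m)) ha
    simp only [Function.comp_def, hδ] at hmean
    intro z
    have := (ha z).2
    have := hmem.1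
    rw [hmean] at this
    linarith
  have h := hmain m 0
  simp only [zero_add, Finset.range_zero, Finset.sum_empty] at h
  refine h.trans ?_
  rw [add_comm (θ * _), Real.exp_add, ENNReal.ofReal_mul (Real.exp_pos _).le]
  refine mul_le_mul_right ?_ _
  calc _ ≤ ∫⁻ _, ENNReal.ofReal (Real.exp (θ * (R - m * δ))) ∂Pr := by
        refine lintegral_mono fun ω => ENNReal.ofReal_le_ofReal (Real.exp_le_exp.2 ?_)
        exact mul_le_mul_of_nonneg_left (hV _) hθ
    _ = _ := by simp

/-- The tail bound for one block of transitions: the choice `θ = 8 δ / R ^ 2` makes the bound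
independent of the length `m` of the block. -/
theorem IsMarkovChain.measure_sum_ge_le (hX : IsMarkovChain X π K Pr)
    [IsProbabilityMeasure π] (hπ : Kernel.Invariant K π) {f : S × S → ℝ}
    (hf : Measurable f) {R c : ℝ} (hc : OscLE f c) (hR0 : 0 < R)
    (hR : ∀ m, OscLE (potential (pairKernel K) f m) R) {δ : ℝ} (hδ0 : 0 < δ)
    (hδ : ∫ ω, f (X 1 ω, X 0 ω) ∂Pr = -δ) (b : ℝ) (s m : ℕ) :
    Pr {ω | b ≤ ∑ t ∈ Finset.range m, f (X (s + t + 1) ω, X (s + t) ω)}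
      ≤ ENNReal.ofReal (Real.exp (-(8 * δ * (b - R) / R ^ 2))) := by
  set θ : ℝ := 8 * δ / R ^ 2 with hθ
  have hθ0 : 0 < θ := by positivity
  have hXm := hX.measurable
  have h := hX.lintegral_exp_sum_le hπ hf hc hR hδ hθ0.le s m
  have hmark := meas_ge_le_lintegral_div (μ := Pr) (f := fun ω => ENNReal.ofReal
    (Real.exp (θ * ∑ t ∈ Finset.range m, f (X (s + t + 1) ω, X (s + t) ω))))
    (by fun_prop) (ε := ENNReal.ofReal (Real.exp (θ * b)))
    (by simp [Real.exp_pos]) ENNReal.ofReal_ne_top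
  calc _ ≤ _ := measure_mono (fun ω hω => ?_)
    _ ≤ _ := hmark
    _ ≤ _ := ENNReal.div_le_div_right h _
    _ = _ := by
      rw [← ENNReal.ofReal_div_of_pos (Real.exp_pos _), ← Real.exp_sub]
      congr 2
      rw [hθ]
      field_simp
      ring
  exact ENNReal.ofReal_le_ofReal (Real.exp_le_exp.2 (mul_le_mul_of_nonneg_left hω hθ0.le))

end PairChain

end ScoreCUSUM

namespace ScoreCUSUM

/-! ### Uniform ergodicity implies Doeblin's condition -/

section Minorization

variable {S : Type*} [MeasurableSpace S]

/-- If `K(z, ·)` is within `1/10` of `π` in total variation, then its density with respect to `π` is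
at least `1/2` outside a set of `π`-measure at most `1/5`. -/
theorem measure_rnDeriv_lt_half_le [MeasurableSpace.CountablyGenerated S]
    (K : Kernel S S) [IsMarkovKernel K] (π : Measure S) [IsProbabilityMeasure π]
    (h : ∀ (x : S) (A : Set S), MeasurableSet A → |(K x).real A - π.real A| ≤ 1 / 10) (z : S) :
    π {y | K.rnDeriv (Kernel.const S π) z y < 1 / 2} ≤ ENNReal.ofReal (1 / 5) := by
  set η := Kernel.const S π with hη
  set A : Set S := {y | K.rnDeriv η z y < 1 / 2} with hA
  have hAm : MeasurableSet A := measurableSet_lt (K.measurable_rnDeriv_right η z) measurable_const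
  -- the singular part of `K z` lives on a `π`-null set `N`, which may be discarded
  set N := K.mutuallySingularSetSlice η z with hN
  have hNm : MeasurableSet N := Kernel.measurableSet_mutuallySingularSetSlice K η z
  have hN0 : π N = 0 := by
    have := Kernel.measure_mutuallySingularSetSlice K η z
    rwa [hη, Kernel.const_apply] at this
  have hAN : π (A \ N) = π A := measure_sdiff_null hN0
  have hK : K z (A \ N) ≤ 1 / 2 * π A := by
    have h1 : K z (A \ N) = ∫⁻ y in A \ N, K.rnDeriv η z y ∂π := by
      conv_lhs => rw [← Kernel.rnDeriv_add_singularPart K η]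
      rw [add_apply, Measure.add_apply,
        Kernel.singularPart_of_subset_compl_mutuallySingularSetSlice (fun y hy => hy.2),
        add_zero, Kernel.withDensity_apply' _ (K.measurable_rnDeriv η), hη,
        Kernel.const_apply]
    rw [h1]
    calc _ ≤ ∫⁻ _ in A \ N, 1 / 2 ∂π :=
          setLIntegral_mono measurable_const fun y hy => le_of_lt hy.1
      _ = _ := by rw [setLIntegral_const, hAN]
  have hKr : (K z).real (A \ N) ≤ 1 / 2 * π.real A := by
    have := ENNReal.toReal_mono (by finiteness) hK
    simpa [Measure.real, ENNReal.toReal_mul] using this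
  have h2 := (abs_le.1 (h z (A \ N) (hAm.diff hNm))).1
  have h3 : π.real (A \ N) = π.real A := by rw [Measure.real, hAN, Measure.real]
  rw [h3] at h2
  rw [← ENNReal.ofReal_toReal (measure_ne_top π A)]
  refine ENNReal.ofReal_le_ofReal ?_
  change π.real A ≤ _
  linarith

/-- A kernel that is uniformly close to `π` in total variation has a two-step minorization by the
restriction of `π` to a set `C`: `C` consists of the states `y` that are reached with a density at
least `1/2` from all states but a set of `π`-measure at most `2/5`. -/
theorem exists_minorization_sq [MeasurableSpace.CountablyGenerated S]
    (K : Kernel S S) [IsMarkovKernel K] (π : Measure S) [IsProbabilityMeasure π]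
    (h : ∀ (x : S) (A : Set S), MeasurableSet A → |(K x).real A - π.real A| ≤ 1 / 10) :
    ∃ ν : Measure S, IsProbabilityMeasure ν ∧
      ∀ x, ENNReal.ofReal (1 / 8) • ν ≤ (K ∘ₖ K) x := by
  set r := K.rnDeriv (Kernel.const S π) with hr
  have hrm : Measurable fun z : S × S => r z.1 z.2 := K.measurable_rnDeriv _
  set G : S → Set S := fun y => {z | 1 / 2 ≤ r z y} with hG
  have hGm : ∀ y, MeasurableSet (G y) := fun y =>
    measurableSet_le measurable_const (hrm.comp (measurable_id.prodMk measurable_const))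
  have hGc : Measurable fun y => π (G y)ᶜ := by
    have hs : MeasurableSet {p : S × S | ¬ 1 / 2 ≤ r p.2 p.1} :=
      (measurableSet_le measurable_const (hrm.comp measurable_swap)).compl
    exact measurable_measure_prodMk_left hs
  set C : Set S := {y | π (G y)ᶜ ≤ ENNReal.ofReal (2 / 5)} with hC
  have hCm : MeasurableSet C := measurableSet_le hGc measurable_const
  have hCG : ∀ y ∈ C, ∀ x, ENNReal.ofReal (1 / 2) ≤ K x (G y) := by
    intro y hy x
    have h1 : π.real (G y)ᶜ ≤ 2 / 5 := ENNReal.toReal_le_of_le_ofReal (by norm_num) hy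
    rw [probReal_compl_eq_one_sub (hGm y)] at h1
    have h2 := (abs_le.1 (h x (G y) (hGm y))).1
    rw [← ENNReal.ofReal_toReal (measure_ne_top (K x) (G y))]
    refine ENNReal.ofReal_le_ofReal ?_
    change _ ≤ (K x).real (G y)
    linarith
  have hCπ : 1 / 2 ≤ π.real C := by
    have hint : ∫⁻ y, π (G y)ᶜ ∂π ≤ ENNReal.ofReal (1 / 5) := by
      have hs : MeasurableSet {p : S × S | r p.1 p.2 < 1 / 2} :=
        measurableSet_lt hrm measurable_const
      have e1 : ∫⁻ y, π (G y)ᶜ ∂π = (π.prod π) {p : S × S | r p.1 p.2 < 1 / 2} := by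
        rw [Measure.prod_apply_symm hs]
        refine lintegral_congr fun y => ?_
        congr 1
        ext z
        simp [hG]
      rw [e1, Measure.prod_apply hs]
      calc _ ≤ ∫⁻ _, ENNReal.ofReal (1 / 5) ∂π :=
            lintegral_mono fun z => measure_rnDeriv_lt_half_le K π h z
        _ = _ := by simp
    have hmark := meas_ge_le_lintegral_div (μ := π) hGc.aemeasurable
      (ε := ENNReal.ofReal (2 / 5)) (by simp) ENNReal.ofReal_ne_top
    have hCc : π Cᶜ ≤ ENNReal.ofReal (1 / 2) := by
      calc π Cᶜ ≤ π {y | ENNReal.ofReal (2 / 5) ≤ π (G y)ᶜ} :=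
            measure_mono fun y hy => (not_le.1 (show ¬ π (G y)ᶜ ≤ _ from hy)).le
        _ ≤ _ := hmark
        _ ≤ _ := ENNReal.div_le_div_right hint _
        _ = _ := by
          rw [← ENNReal.ofReal_div_of_pos (by norm_num)]
          norm_num
    have h1 : π.real Cᶜ ≤ 1 / 2 := ENNReal.toReal_le_of_le_ofReal (by norm_num) hCc
    rw [probReal_compl_eq_one_sub hCm] at h1
    linarith
  have hC0 : π C ≠ 0 := by
    intro h0
    rw [Measure.real, h0] at hCπ
    norm_num at hCπ
  refine ⟨cond π C, cond_isProbabilityMeasure hC0, fun x => ?_⟩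
  refine Measure.le_iff.2 fun A hA => ?_
  have hbind : (K ∘ₖ K) x A = ∫⁻ z, K z A ∂(K x) := Kernel.comp_apply' _ _ _ hA
  have hrmA : ∀ z, ∫⁻ y in A ∩ C, r z y ∂π ≤ K z A := by
    intro z
    have := Kernel.setLIntegral_rnDeriv_le (κ := K) (η := Kernel.const S π) (a := z)
      (hA.inter hCm)
    rw [Kernel.const_apply] at this
    exact this.trans (measure_mono inter_subset_left)
  calc (ENNReal.ofReal (1 / 8) • cond π C) A
      = ENNReal.ofReal (1 / 8) * ((π C)⁻¹ * π (A ∩ C)) := by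
        rw [Measure.smul_apply, cond_apply hCm, inter_comm, smul_eq_mul]
    _ ≤ ENNReal.ofReal (1 / 8) * (2 * π (A ∩ C)) := by
        gcongr
        rw [ENNReal.inv_le_iff_inv_le, ← ENNReal.ofReal_toReal (measure_ne_top π C)]
        have : (2 : ℝ≥0∞)⁻¹ = ENNReal.ofReal (1 / 2) := by
          rw [one_div, ENNReal.ofReal_inv_of_pos (by norm_num)]; simp
        rw [this]
        exact ENNReal.ofReal_le_ofReal hCπ
    _ = ∫⁻ _ in A ∩ C, ENNReal.ofReal (1 / 4) ∂π := by
        rw [setLIntegral_const, ← mul_assoc]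
        congr 1
        rw [show (2 : ℝ≥0∞) = ENNReal.ofReal 2 by simp, ← ENNReal.ofReal_mul (by norm_num)]
        norm_num
    _ ≤ ∫⁻ y in A ∩ C, ∫⁻ z, r z y ∂(K x) ∂π := by
        refine setLIntegral_mono' (hA.inter hCm) fun y hy => ?_
        calc ENNReal.ofReal (1 / 4) = 1 / 2 * ENNReal.ofReal (1 / 2) := by
              rw [show (1 / 2 : ℝ≥0∞) = ENNReal.ofReal (1 / 2) by
                rw [one_div, one_div, ENNReal.ofReal_inv_of_pos (by norm_num)]; simp,
                ← ENNReal.ofReal_mul (by norm_num)]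
              norm_num
          _ ≤ 1 / 2 * K x (G y) := by gcongr; exact hCG y hy.2 x
          _ = ∫⁻ _ in G y, 1 / 2 ∂(K x) := by rw [setLIntegral_const]
          _ ≤ ∫⁻ z in G y, r z y ∂(K x) := setLIntegral_mono' (hGm y) fun z hz => hz
          _ ≤ _ := setLIntegral_le_lintegral _ _
    _ = ∫⁻ z, ∫⁻ y in A ∩ C, r z y ∂π ∂(K x) :=
        lintegral_lintegral_swap (hrm.comp measurable_swap).aemeasurable
    _ ≤ ∫⁻ z, K z A ∂(K x) := lintegral_mono hrmA
    _ = (K ∘ₖ K) x A := hbind.symm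

theorem UniformlyErgodic.exists_doeblin [MeasurableSpace.CountablyGenerated S]
    {K : Kernel S S} [IsMarkovKernel K] {π : Measure S} [IsProbabilityMeasure π]
    (h : UniformlyErgodic K π) : ∃ (l : ℕ) (lam : ℝ), Doeblin K l lam := by
  obtain ⟨n, hn, hn1⟩ := ((h.2 (1 / 10) (by norm_num)).and (eventually_ge_atTop 1)).exists
  obtain ⟨ν, hν, hle⟩ := exists_minorization_sq (K ^ n) π hn
  refine ⟨n + n, 1 / 8, by omega, by norm_num, ν, hν, fun x => ?_⟩
  rw [Kernel.pow_add]
  exact hle x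

theorem pairKernel_pow_succ_apply (K : Kernel S S) [IsMarkovKernel K] (m : ℕ) (z : S × S) :
    (pairKernel K ^ (m + 1)) z = ((K ^ m) z.1).bind (K ×ₖ Kernel.id) := by
  induction m with
  | zero =>
    rw [zero_add, pow_one, pairKernel_apply]
    change _ = (Kernel.id z.1).bind _
    rw [Kernel.id_apply, Measure.dirac_bind (Kernel.measurable _)]
  | succ m ih =>
    ext s hs
    have hm : Measurable fun x : S => (K ×ₖ Kernel.id) x s := Kernel.measurable_coe _ hs
    rw [Kernel.pow_succ_apply_eq_lintegral _ _ _ hs, ih,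
      Measure.lintegral_bind (Kernel.aemeasurable _) (Kernel.measurable_coe _ hs).aemeasurable,
      Measure.bind_apply hs (Kernel.aemeasurable _), add_comm m 1, Kernel.pow_add, pow_one,
      Kernel.lintegral_comp _ _ _ hm]
    refine lintegral_congr fun x => ?_
    simp_rw [pairKernel_apply]
    exact Kernel.lintegral_prod_id (hm.comp measurable_fst) K x

/-- Doeblin's condition passes from a chain to its pair chain, at the cost of one more step. -/
theorem Doeblin.pairKernel {K : Kernel S S} [IsMarkovKernel K] {l : ℕ} {lam : ℝ}
    (h : Doeblin K l lam) : Doeblin (pairKernel K) (l + 1) lam := by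
  obtain ⟨hl, hlam, ν, hν, hle⟩ := h
  refine ⟨by omega, hlam, ν.bind (K ×ₖ Kernel.id), inferInstance, fun z => ?_⟩
  rw [pairKernel_pow_succ_apply]
  refine Measure.le_iff.2 fun A hA => ?_
  rw [Measure.smul_apply, Measure.bind_apply hA (Kernel.aemeasurable _),
    Measure.bind_apply hA (Kernel.aemeasurable _), ← lintegral_smul_measure]
  exact lintegral_mono' (hle z.1) le_rfl

end Minorization

end ScoreCUSUM

namespace ScoreCUSUM

/-! ### From block tail bounds to the mean of the CUSUM time -/

section CusumTime

/-- Over real `N` the right side is nearly maximal at `N = s`; the integer nearest to `s` suffices, the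
term `c N / 6` absorbing the rounding. -/
theorem exists_nat_le_sub_cube {s c : ℝ} (hs : 1 ≤ s) (hc : c = 2 / s ^ 2) :
    ∃ N : ℕ, 2 * s / 3 ≤ N - c * (N ^ 3 - N) / 6 := by
  have hs0 : 0 < s := by linarith
  refine ⟨⌊s + 1 / 2⌋₊, ?_⟩
  have h1 := Nat.floor_le (show 0 ≤ s + 1 / 2 by linarith)
  have h2 := Nat.lt_floor_add_one (s + 1 / 2)
  have h3 : 1 ≤ ⌊s + 1 / 2⌋₊ := Nat.le_floor (by push_cast; linarith)
  have h4 : (1 : ℝ) ≤ (⌊s + 1 / 2⌋₊ : ℝ) := by exact_mod_cast h3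
  set N : ℝ := (⌊s + 1 / 2⌋₊ : ℝ)
  have hsq : (s - N) ^ 2 ≤ 1 / 4 := by nlinarith
  -- `2 s³ - 3 s² N + N³ = (s - N)² (2 s + N)`
  have hpoly : (s - N) ^ 2 * (2 * s + N) ≤ N := by nlinarith
  rw [hc, ← sub_nonneg]
  have : N - 2 / s ^ 2 * (N ^ 3 - N) / 6 - 2 * s / 3
      = (N - (s - N) ^ 2 * (2 * s + N)) / (3 * s ^ 2) := by
    field_simp
    ring
  rw [this]
  exact div_nonneg (by linarith) (by positivity)

theorem sum_range_one_sub_triangle (c : ℝ) (N : ℕ) :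
    ∑ n ∈ Finset.range N, (1 - (n * (n + 1) / 2 : ℝ) * c) = N - c * (N ^ 3 - N) / 6 := by
  induction N with
  | zero => simp
  | succ N ih => rw [Finset.sum_range_succ, ih]; push_cast; ring

variable {S : Type*}

/-- If no block of transitions ending at a time at most `n` has a sum of at least `b`, then the
CUSUM time exceeds `n`. -/
theorem succ_le_cusumTime {f : S → S → ℝ} {b : ℝ} {x : ℕ → S} {n : ℕ}
    (h : ∀ j < n, ∀ s < j + 1,
      ∑ t ∈ Finset.range (j + 1 - s), f (x (s + t + 1)) (x (s + t)) < b) :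
    ((n + 1 : ℕ) : ℕ∞) ≤ cusumTime f b x := by
  refine le_iInf₂ fun N hN => ?_
  obtain ⟨hN1, hNb⟩ := hN
  rw [Nat.cast_le]
  by_contra hlt
  have : Nonempty (Finset.Icc 1 N) := ⟨⟨1, by simp [hN1]⟩⟩
  obtain ⟨⟨k, hk⟩, hkeq⟩ := exists_eq_ciSup_of_finite
    (f := fun k : Finset.Icc 1 N => ∑ t ∈ Finset.Icc (k : ℕ) N, f (x t) (x (t - 1)))
  rw [cusum, ← hkeq] at hNb
  rw [Finset.mem_Icc] at hk
  have h1 := h (N - 1) (by omega) (k - 1) (by omega)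
  refine absurd hNb (not_le.2 (lt_of_eq_of_lt ?_ h1))
  rw [← Finset.Ico_add_one_right_eq_Icc, Finset.sum_Ico_eq_sum_range,
    show N - 1 + 1 - (k - 1) = N + 1 - k by omega]
  refine Finset.sum_congr rfl fun t _ => ?_
  rw [show k - 1 + t + 1 = k + t by omega, show k - 1 + t = k + t - 1 by omega]

theorem sum_ite_succ_le (T : ℕ∞) (N : ℕ) :
    ∑ n ∈ Finset.range N, (if ((n + 1 : ℕ) : ℕ∞) ≤ T then (1 : ℝ≥0∞) else 0) ≤ (T : ℝ≥0∞) := by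
  induction T using ENat.recTopCoe with
  | top => simp
  | coe k =>
    simp only [Nat.cast_le, Finset.sum_boole, ENat.toENNReal_coe]
    have : (Finset.range N).filter (fun n => n + 1 ≤ k) ⊆ Finset.range k := by
      intro n hn
      simp only [Finset.mem_filter, Finset.mem_range] at hn ⊢
      omega
    exact_mod_cast (Finset.card_le_card this).trans (Finset.card_range k).le

variable [MeasurableSpace S] {Ω : Type*} [MeasurableSpace Ω] {Pr : Measure Ω}
  [IsProbabilityMeasure Pr] {X : ℕ → Ω → S}

/-- If every block sum reaches `b` with probability at most `e^{-2a}`, then the mean CUSUM time is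
at least `(2 √2 / 3) e^a`. -/
theorem le_lintegral_cusumTime (hX : ∀ n, Measurable (X n)) {f : S → S → ℝ}
    (hf : Measurable fun z : S × S => f z.1 z.2) {a b : ℝ} (ha : 0 ≤ a)
    (htail : ∀ s m : ℕ, Pr {ω | b ≤ ∑ t ∈ Finset.range m, f (X (s + t + 1) ω) (X (s + t) ω)}
      ≤ ENNReal.ofReal (Real.exp (-(2 * a)))) :
    ENNReal.ofReal (2 * √2 / 3 * Real.exp a)
      ≤ ∫⁻ ω, ((cusumTime f b (fun t => X t ω) : ℕ∞) : ℝ≥0∞) ∂Pr := by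
  set c := Real.exp (-(2 * a)) with hc
  let E : ℕ → ℕ → Set Ω := fun s m =>
    {ω | b ≤ ∑ t ∈ Finset.range m, f (X (s + t + 1) ω) (X (s + t) ω)}
  have hE : ∀ s m, MeasurableSet (E s m) := fun s m =>
    measurableSet_le measurable_const (Finset.measurable_sum _ fun t _ =>
      hf.comp ((hX (s + t + 1)).prodMk (hX (s + t))))
  let bad : ℕ → Set Ω := fun n =>
    ⋃ j ∈ Finset.range n, ⋃ s ∈ Finset.range (j + 1), E s (j + 1 - s)
  have hbad : ∀ n, MeasurableSet (bad n) := fun n =>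
    Finset.measurableSet_biUnion _ fun j _ => Finset.measurableSet_biUnion _ fun s _ => hE _ _
  have hbadPr : ∀ n, Pr.real (bad n) ≤ (n * (n + 1) / 2 : ℝ) * c := by
    intro n
    have hEr : ∀ s m, Pr.real (E s m) ≤ c := fun s m =>
      ENNReal.toReal_le_of_le_ofReal (Real.exp_pos _).le (htail s m)
    calc Pr.real (bad n) ≤ ∑ j ∈ Finset.range n, ∑ s ∈ Finset.range (j + 1),
          Pr.real (E s (j + 1 - s)) :=
          (measureReal_biUnion_finset_le _ _).trans
            (Finset.sum_le_sum fun j _ => measureReal_biUnion_finset_le _ _)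
      _ ≤ ∑ j ∈ Finset.range n, ∑ s ∈ Finset.range (j + 1), c :=
          Finset.sum_le_sum fun j _ => Finset.sum_le_sum fun s _ => hEr _ _
      _ = _ := by
          induction n with
          | zero => simp
          | succ n ih =>
            rw [Finset.sum_range_succ, ih]
            simp only [Finset.sum_const, Finset.card_range, nsmul_eq_mul]
            push_cast
            ring
  have hmean : ∀ N : ℕ, ENNReal.ofReal (N - c * (N ^ 3 - N) / 6)
      ≤ ∫⁻ ω, ((cusumTime f b (fun t => X t ω) : ℕ∞) : ℝ≥0∞) ∂Pr := by
    intro N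
    rw [← sum_range_one_sub_triangle]
    calc _ ≤ ENNReal.ofReal (∑ n ∈ Finset.range N, Pr.real (bad n)ᶜ) := by
          refine ENNReal.ofReal_le_ofReal (Finset.sum_le_sum fun n _ => ?_)
          rw [probReal_compl_eq_one_sub (hbad n)]
          linarith [hbadPr n]
      _ = ∑ n ∈ Finset.range N, Pr (bad n)ᶜ := by
          rw [ENNReal.ofReal_sum_of_nonneg fun n _ => measureReal_nonneg]
          simp
      _ = ∫⁻ ω, ∑ n ∈ Finset.range N, (bad n)ᶜ.indicator 1 ω ∂Pr := by
          rw [lintegral_finsetSum _ fun n _ => measurable_one.indicator (hbad n).compl]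
          simp_rw [lintegral_indicator_one (hbad _).compl]
      _ ≤ _ := by
          refine lintegral_mono fun ω => le_trans (Finset.sum_le_sum fun n _ => ?_)
            (sum_ite_succ_le _ N)
          by_cases hω : ω ∈ bad n
          · simp [hω]
          · rw [if_pos]
            · exact indicator_le_self' (fun _ _ => zero_le) ω
            · refine succ_le_cusumTime fun j hj s hs => ?_
              by_contra hge
              refine hω ?_
              simp only [bad, mem_iUnion, Finset.mem_range]
              exact ⟨j, hj, s, hs, not_lt.1 hge⟩
  have hs1 : 1 ≤ √2 * Real.exp a := by
    have h2 : (1 : ℝ) ≤ √2 := Real.one_le_sqrt.2 (by norm_num)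
    exact one_le_mul_of_one_le_of_one_le h2 (Real.one_le_exp ha)
  have hcs : c = 2 / (√2 * Real.exp a) ^ 2 := by
    rw [mul_pow, Real.sq_sqrt (by norm_num), ← Real.exp_nat_mul, hc, Real.exp_neg]
    push_cast
    field_simp
  obtain ⟨N, hN⟩ := exists_nat_le_sub_cube hs1 hcs
  refine (ENNReal.ofReal_le_ofReal ?_).trans (hmean N)
  linarith

end CusumTime

/-! ### The truncated score -/

section Score

variable {d : ℕ} {𝕏 : Set (EuclideanSpace ℝ (Fin d))}

theorem measurable_trunc (M : ℝ) : Measurable (trunc M) :=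
  Measurable.ite (measurableSet_le measurable_id.abs measurable_const) measurable_id
    (Measurable.ite (measurableSet_lt measurable_const measurable_id) measurable_const
      measurable_const)

theorem abs_trunc_le {M : ℝ} (hM : 0 ≤ M) (x : ℝ) : |trunc M x| ≤ M := by
  unfold trunc
  split_ifs with h1 h2
  · exact h1
  · exact (abs_of_nonneg hM).le
  · rw [abs_neg, abs_of_nonneg hM]

theorem truncScoreNorm_nonneg (p q : 𝕏 → EuclideanSpace ℝ (Fin d) → ℝ) (M : ℝ) :
    0 ≤ truncScoreNorm p q M :=
  Real.iSup_nonneg fun _ => abs_nonneg _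

theorem abs_trunc_scoreDiff_le (p q : 𝕏 → EuclideanSpace ℝ (Fin d) → ℝ) {M : ℝ} (hM : 0 ≤ M)
    {y x : 𝕏} (h : 0 < p x y) : |trunc M (scoreDiff p q y x)| ≤ truncScoreNorm p q M :=
  le_ciSup (f := fun z : {z : 𝕏 × 𝕏 // 0 < p z.2 z.1} => |trunc M (scoreDiff p q z.1.1 z.1.2)|)
    ⟨M, by rintro _ ⟨z, rfl⟩; exact abs_trunc_le hM _⟩ ⟨(y, x), h⟩

theorem IsTransitionDensity.ae_pos {ρ : Measure 𝕏} {p : 𝕏 → EuclideanSpace ℝ (Fin d) → ℝ}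
    (hp : IsTransitionDensity ρ p) (x : 𝕏) :
    ∀ᵐ y : 𝕏 ∂(ρ.withDensity fun y : 𝕏 => ENNReal.ofReal (p x y)), 0 < p x y := by
  have hm : Measurable fun y : 𝕏 => p x y :=
    hp.measurable.comp (measurable_const.prodMk measurable_id)
  rw [ae_withDensity_iff hm.ennreal_ofReal]
  refine .of_forall fun y hy => ?_
  simpa using hy

end Score

end ScoreCUSUM

theorem theorem1 {d : ℕ} {𝕏 : Set (EuclideanSpace ℝ (Fin d))} (h𝕏 : IsOpen 𝕏)
    -- reference measure, pre-change density `p` with kernel `P`, post-change density `q`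
    (ρ : Measure 𝕏) [SigmaFinite ρ]
    (p q : 𝕏 → EuclideanSpace ℝ (Fin d) → ℝ)
    (hp : ScoreCUSUM.IsTransitionDensity ρ p) (hq : ScoreCUSUM.IsTransitionDensity ρ q)
    (P : Kernel 𝕏 𝕏) [IsMarkovKernel P]
    (hP : ∀ x : 𝕏, P x = ρ.withDensity (fun y : 𝕏 => ENNReal.ofReal (p x y)))
    (hs : Measurable (fun z : 𝕏 × 𝕏 => ScoreCUSUM.scoreDiff p q z.1 z.2))
    -- `P` is uniformly ergodic with stationary law `π`; under no change, `X` is the stationary chain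
    (π : Measure 𝕏) [IsProbabilityMeasure π] (hπ : ScoreCUSUM.UniformlyErgodic P π)
    {Ω : Type*} [MeasurableSpace Ω] (Pr : Measure Ω) [IsProbabilityMeasure Pr]
    (X : ℕ → Ω → 𝕏) (hX : ScoreCUSUM.IsMarkovChain X π P Pr)
    -- truncation level and negative drift
    (M : ℝ) (hM : 0 < M) (δ : ℝ) (hδ : 0 < δ)
    (hdrift : ∫ ω, ScoreCUSUM.trunc M (ScoreCUSUM.scoreDiff p q (X 1 ω) (X 0 ω)) ∂Pr = -δ) :
    (∃ (l : ℕ) (lam : ℝ), ScoreCUSUM.Doeblin (ScoreCUSUM.pairKernel P) l lam) ∧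
    ∀ (l : ℕ) (lam : ℝ), ScoreCUSUM.Doeblin (ScoreCUSUM.pairKernel P) l lam →
      ∀ μ : ℝ, μ = 2 * ((l : ℝ) + 1) * ScoreCUSUM.truncScoreNorm p q M / lam →
        ∀ b : ℝ, μ < b →
          ENNReal.ofReal (2 * √2 / 3 * Real.exp (4 * δ * (b - μ) / μ ^ 2))
            ≤ ∫⁻ ω, ((ScoreCUSUM.stoppingTime p q M b X ω : ℕ∞) : ℝ≥0∞) ∂Pr := by
  have := nonempty_of_isProbabilityMeasure π
  obtain ⟨l₀, lam₀, h₀⟩ := hπ.exists_doeblin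
  refine ⟨⟨l₀ + 1, lam₀, h₀.pairKernel⟩, fun l lam hD μ hμ b hb => ?_⟩
  set B := ScoreCUSUM.truncScoreNorm p q M with hBdef
  have hB0 : 0 ≤ B := ScoreCUSUM.truncScoreNorm_nonneg p q M
  let f : 𝕏 → 𝕏 → ℝ := fun y x => ScoreCUSUM.trunc M (ScoreCUSUM.scoreDiff p q y x)
  have hf : Measurable fun z : 𝕏 × 𝕏 => f z.1 z.2 := (ScoreCUSUM.measurable_trunc M).comp hs
  -- off the set `p > 0` the score may exceed `B`; clipping it changes nothing along the chain
  let g : 𝕏 × 𝕏 → ℝ := fun z => max (-B) (min (f z.1 z.2) B)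
  have hg : Measurable g := measurable_const.max (hf.min measurable_const)
  have hgB : ∀ z, |g z| ≤ B := fun z =>
    abs_le.2 ⟨le_max_left _ _, max_le (by linarith) (min_le_right _ _)⟩
  have hfg : ∀ n, ∀ᵐ ω ∂Pr, g (X (n + 1) ω, X n ω) = f (X (n + 1) ω) (X n ω) := by
    have hA : MeasurableSet {z : 𝕏 × 𝕏 | 0 < p z.2 z.1} :=
      measurableSet_lt measurable_const (hp.measurable.comp measurable_swap)
    intro n
    filter_upwards [hX.ae_transition hA (fun x => by rw [hP x]; exact hp.ae_pos x) n] with ω hω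
    have h := abs_le.1 (ScoreCUSUM.abs_trunc_scoreDiff_le p q hM.le hω)
    simp only [g]
    rw [min_eq_left h.2, max_eq_right h.1]
  have hgδ : ∫ ω, g (X 1 ω, X 0 ω) ∂Pr = -δ := by
    rw [← hdrift]
    exact integral_congr_ae (hfg 0)
  have hBpos : 0 < B := by
    have h := norm_integral_le_of_norm_le_const (μ := Pr) (f := fun ω => g (X 1 ω, X 0 ω))
      (C := B) (.of_forall fun ω => hgB _)
    rw [hgδ, norm_neg, Real.norm_eq_abs, abs_of_pos hδ, probReal_univ, mul_one] at h
    linarith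
  have hosc : ScoreCUSUM.OscLE g (2 * B) := .of_abs_le hgB
  have hlam : 0 < lam := hD.2.1
  have hμ0 : 0 < μ := by rw [hμ]; positivity
  have hR : ∀ m, ScoreCUSUM.OscLE (ScoreCUSUM.potential (ScoreCUSUM.pairKernel P) g m) μ := by
    intro m
    refine (hD.potential_oscLE hg (by positivity) hosc m).mono ?_
    rw [hμ]
    exact div_le_div_of_nonneg_right (by nlinarith) hlam.le
  have htail : ∀ s m : ℕ, Pr {ω | b ≤ ∑ t ∈ Finset.range m, f (X (s + t + 1) ω) (X (s + t) ω)}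
      ≤ ENNReal.ofReal (Real.exp (-(2 * (4 * δ * (b - μ) / μ ^ 2)))) := by
    intro s m
    have h := hX.measure_sum_ge_le hπ.1 hg hosc hμ0 hR hδ hgδ b s m
    rw [show 2 * (4 * δ * (b - μ) / μ ^ 2) = 8 * δ * (b - μ) / μ ^ 2 by ring]
    refine le_trans (measure_mono_ae ?_) h
    filter_upwards [ae_all_iff.2 hfg] with ω hω hmem
    change b ≤ ∑ t ∈ Finset.range m, g (X (s + t + 1) ω, X (s + t) ω)
    simp only [hω]
    exact hmem
  exact ScoreCUSUM.le_lintegral_cusumTime hX.measurable hf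
    (div_nonneg (by nlinarith) (by positivity)) htail
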